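/- **Theorem.** Let $1\le e<k$ and $n\ge 2k-1$ be integers, and put $\alpha=k-1$ and $d'=2k-e-1$. There is a number $q_0=q_0(n,k,e)$ such that for every finite field $F$ with $|F|\ge q_0$ there are evaluation points $x_1,\dots,x_n\in F$ for which the following holds. Let $\phi_i=(1,x_i,\dots,x_i^{\alpha-1})^t$ be the $i$-th row of the matrix $\Phi$, let $\Lambda=\mathrm{diag}(x_1^\alpha,\dots,x_n^\alpha)$ and $\Psi=[\Phi\;\;\Lambda\Phi]$. For symmetric $\alpha\times\alpha$ matrices $S_1,S_2$ over $F$ (whose upper triangles are filled with the $\alpha(\alpha+1)$ message symbols), node $i$ stores the $i$-th row $w_i^t$ of $\Psi M$, where $M=\begin{bmatrix}S_1\\S_2\end{bmatrix}$. 1. Any $2\alpha$ rows of $\Psi$ are linearly independent, any $\alpha$ rows of $\Phi$ are linearly independent, and $x_1^\alpha,\dots,x_n^\alpha$ are distinct (so this is a product-matrix code). 2. The code is an exact-repair $(n,k,d',e,k-1,e)$ MSMR code for a file of $\mathcal M=k(k-1)$ symbols. That is, the contents of any $k$ nodes determine the message; any $e$ failed nodes are exactly recovered by a central node from any $d'$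 other nodes, each of which sends $\beta=e$ symbols of $F$ computed from its own content; and the storage per node and the total repair bandwidth are those of the minimum storage multi-node repair point, $\alpha=\mathcal M/k$ and $d'\beta=\frac{\mathcal M}{k}\cdot\frac{e d'}{d'-k+e}$. 3. This bandwidth is optimal: for every code that stores the same messages on $n$ nodes with $\alpha$ symbols of $F$ per node, such that any $k$ nodes determine the message, every exact repair of $e$ nodes from $d'$ other nodes (by arbitrary functions, with possibly different numbers of symbols from different helpers) downloads at least $d'e$ symbols in total. 4. The repair can be done as follows. List any $2\alpha+1$ distinct nodes, write $1,\dots,2\alpha+1$ for them, and let the first $e$ be the failed ones and the other $d'$ the helpers. Helper $l$ sends $s_{l,i}=w_l^t\phi_i$ for $i=1,\dots,e$. For $i\le e$ let $\Psi_i$ be the matrix of the rows of $\Psi$ of the $2\alpha$ listed nodes other than $i$; the single-erasure repair of node $i$ is $w_i=[I_\alpha\;\;x_i^\alpha I_\alpha]\,\Psi_i^{-1}(s_{l,i})_{l\ne i}$. Substituting it into $s_{i,j}=\phi_j^tw_i$ gives the square linear system $$-s_{i,j}+\sum_{l\le e,\;l\ne i}c^{\,i,j}_l\,s_{l,i}=-\sum_{l>e}c^{\,i,j}_l\,s_{l,i}\qquad(i\ne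 j,\ i,j\le e)$$ for the $e(e-1)$ unknown cross terms $s_{i,j}$, where $c^{\,i,j}_l=[\phi_j^t\;\;x_i^\alpha\phi_j^t]\,\Psi_i^{-1}\mathbf e_{l,i}$ and $\mathbf e_{l,i}$ is the standard basis vector at the position of node $l$ in the list with $i$ removed. The matrix of this system is nonsingular, and solving the system and then applying the single-erasure repair to every failed node returns the contents $w_1,\dots,w_e$. The same evaluation points $x_1,\dots,x_n$ serve all sets of $e$ failed nodes and all sets of $d'$ helpers. -/

import Mathlib

open Matrix

section Codes

/-- A code storing a message of type `Msg` on `n` nodes, each holding `α` symbols of `F`: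
`C m i` is the content of node `i`.  Reconstruction property: the contents of any `k` nodes
determine the whole message. -/
def Reconstructs {Msg F : Type*} {n α : ℕ} (C : Msg → Fin n → Fin α → F) (k : ℕ) : Prop :=
  ∀ K : Finset (Fin n), K.card = k →
    ∀ m m' : Msg, (∀ i ∈ K, C m i = C m' i) → m = m'

/-- An exact centralized repair of the failed nodes `E` from the helper nodes `H`: helper `h`
sends `b h` symbols that are a function of its own content, and from all the received symbols the
central node recomputes the contents of the failed nodes. -/
structure ExactRepair {Msg F : Type*} {n α : ℕ} (C : Msg → Fin n → Fin α → F)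
    (E H : Finset (Fin n)) (b : H → ℕ) where
  send : ∀ h : H, (Fin α → F) → (Fin (b h) → F)
  recover : (∀ h : H, Fin (b h) → F) → E → Fin α → F
  correct : ∀ (m : Msg) (i : E), recover (fun h => send h (C m h)) i = C m i

/-- `C` is an exact-repair `(n, k, d, e, α, β)` MSMR code for a file of `M` symbols of `F`:
any `k` nodes reconstruct the file, any `e` failed nodes are exactly repaired from any `d` other
nodes, each sending `β` symbols, and storage and total bandwidth `d β` are those of the minimum
storage multi-node repair point, `α = M / k` and `d β = (M / k) (e d / (d - k + e))`. -/
structure IsMSMRCode {Msg F : Type*} {n α : ℕ} (C : Msg → Fin n → Fin α → F)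
    (M k d e β : ℕ) : Prop where
  file_size : Nat.card Msg = Nat.card F ^ M
  k_le_d : k ≤ d
  d_add_e_le_n : d + e ≤ n
  reconstruct : Reconstructs C k
  repair : ∀ E H : Finset (Fin n), E.card = e → H.card = d → Disjoint E H →
    Nonempty (ExactRepair C E H fun _ => β)
  storage : (α : ℚ) = (M : ℚ) / k
  bandwidth : (d : ℚ) * β = (M : ℚ) / k * ((e : ℚ) * d / ((d : ℚ) - k + e))

end Codes

section ProductMatrix

variable {F : Type*} [Field F] {n α : ℕ}

/-- The message: two families of `α (α + 1) / 2` symbols, indexed by unordered pairs, that fill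
the two symmetric matrices `S₁` and `S₂`. -/
abbrev PMMessage (α : ℕ) (F : Type*) : Type _ :=
  (Sym2 (Fin α) → F) × (Sym2 (Fin α) → F)

/-- The symmetric matrix whose upper triangle is filled with the given symbols. -/
def symMatrix (x : Sym2 (Fin α) → F) : Matrix (Fin α) (Fin α) F :=
  Matrix.of fun i j => x s(i, j)

/-- `M = [S₁; S₂]`. -/
def messageMatrix (m : PMMessage α F) : Matrix (Fin α ⊕ Fin α) (Fin α) F :=
  Matrix.fromRows (symMatrix m.1) (symMatrix m.2)

/-- `Ψ = [Φ, Λ Φ]` with `Λ = diag L`. -/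
def encodingMatrix (Φ : Matrix (Fin n) (Fin α) F) (L : Fin n → F) :
    Matrix (Fin n) (Fin α ⊕ Fin α) F :=
  Matrix.fromCols Φ (Matrix.diagonal L * Φ)

/-- The conditions on the encoding matrix of a product-matrix code (with `d = 2 α`). -/
structure IsPMEncoding (Φ : Matrix (Fin n) (Fin α) F) (L : Fin n → F) : Prop where
  psi_rows : ∀ s : Finset (Fin n), s.card = 2 * α →
    LinearIndependent F fun i : s => encodingMatrix Φ L i
  phi_rows : ∀ s : Finset (Fin n), s.card = α → LinearIndependent F fun i : s => Φ i
  lambda_injective : Function.Injective L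

/-- The product-matrix code: node `i` stores row `i` of `Ψ M`. -/
def pmCode (Φ : Matrix (Fin n) (Fin α) F) (L : Fin n → F) (m : PMMessage α F) :
    Fin n → Fin α → F :=
  fun i => (encodingMatrix Φ L * messageMatrix m) i

/-- The Vandermonde choice of `Φ` with evaluation points `x`; it goes with `Λ = diag (x i ^ α)`,
so that row `i` of `Ψ` is `(1, x i, …, x i ^ (2 α - 1))`. -/
def vandermondePhi (α : ℕ) (x : Fin n → F) : Matrix (Fin n) (Fin α) F :=
  Matrix.of fun i c => x i ^ (c : ℕ)

/-! In a repair, the `2 α + 1` nodes involved are listed as `v 0, …, v (2 α)`: the first `e` of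
them have failed, the others are the helpers. -/

/-- Positions of the failed nodes. -/
abbrev FailedPos (α e : ℕ) : Type := {i : Fin (α + α + 1) // i.val < e}

/-- Positions of the helper nodes. -/
abbrev HelperPos (α e : ℕ) : Type := {l : Fin (α + α + 1) // e ≤ l.val}

/-- Index pairs `(i, j)`, `i ≠ j`, of the unknown cross terms `s i j` (what the failed node `i`
would send for the repair of the failed node `j`). -/
abbrev CrossPair (α e : ℕ) : Type := {p : FailedPos α e × FailedPos α e // p.1 ≠ p.2}

variable (Φ : Matrix (Fin n) (Fin α) F) (L : Fin n → F) (v : Fin (α + α + 1) → Fin n)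

/-- The square matrix of the rows of `Ψ` of all the listed nodes except `v i`, in their order. -/
def helperRows (i : Fin (α + α + 1)) : Matrix (Fin α ⊕ Fin α) (Fin α ⊕ Fin α) F :=
  (encodingMatrix Φ L).submatrix (fun r => v (i.succAbove (finSumFinEquiv r))) id

/-- Single-erasure repair of node `v i`: given the symbols `s l = s_{l,i}` from all the other
listed nodes (the entry `s i` is not used), it returns `[I, λ_i I] Ψ_{H_i}⁻¹ s`, where `λ_i` is
the diagonal entry of `Λ`. -/
noncomputable def pmDecode (i : Fin (α + α + 1)) (s : Fin (α + α + 1) → F) : Fin α → F :=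
  Matrix.fromCols (1 : Matrix (Fin α) (Fin α) F) (L (v i) • (1 : Matrix (Fin α) (Fin α) F)) *ᵥ
    ((helperRows Φ L v i)⁻¹ *ᵥ fun r => s (i.succAbove (finSumFinEquiv r)))

/-- The coefficient of `s_{l,i}` in `s_{i,j} = φ_jᵀ w_i` when `w_i` is obtained by single-erasure
repair, that is `[φ_jᵀ, λ_i φ_jᵀ] Ψ_{H_i}⁻¹ e_{l,i}`. -/
noncomputable def crossCoeff (i j l : Fin (α + α + 1)) : F :=
  Φ (v j) ⬝ᵥ pmDecode Φ L v i (Pi.single l 1)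

/-- The matrix `A` of the linear system for the cross terms. -/
noncomputable def repairMatrix (e : ℕ) : Matrix (CrossPair α e) (CrossPair α e) F :=
  Matrix.of fun p q =>
    if q = p then -1
    else if q.1.2 = p.1.1 then crossCoeff Φ L v p.1.1 p.1.2 q.1.1
    else 0

/-- The right-hand side of the linear system, computed from the downloaded symbols
`y l i = s_{l,i}`. -/
noncomputable def repairRhs (e : ℕ) (y : HelperPos α e → FailedPos α e → F) :
    CrossPair α e → F :=
  fun p => -∑ l : HelperPos α e, crossCoeff Φ L v p.1.1 p.1.2 l * y l p.1.1

/-- Multi-node repair: solve the linear system for the cross terms, then run the single-erasure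
repair of the failed node `v i` on the downloaded symbols and the cross terms. -/
noncomputable def pmRepair (e : ℕ) (y : HelperPos α e → FailedPos α e → F)
    (i : FailedPos α e) : Fin α → F :=
  let s : CrossPair α e → F := (repairMatrix Φ L v e)⁻¹ *ᵥ repairRhs Φ L v e y
  pmDecode Φ L v i fun l =>
    if hl : l.val < e then
      if hne : (⟨l, hl⟩ : FailedPos α e) ≠ i then s ⟨(⟨l, hl⟩, i), hne⟩ else 0
    else y ⟨l, not_lt.mp hl⟩ i

/-- The symbols downloaded: the helper `v l` sends `w_lᵀ φ_i` for each of the `e` failed nodes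
`v i`. -/
def pmDownload (e : ℕ) (m : PMMessage α F) : HelperPos α e → FailedPos α e → F :=
  fun l i => pmCode Φ L m (v l) ⬝ᵥ Φ (v i)

end ProductMatrix

/-! Write `α = k - 1` and `λ_i = x_i ^ α`. By symmetry of `S₁`, `S₂`, the products `φ_jᵀ w_i` and
`φ_iᵀ w_j` determine `φ_jᵀ S₁ φ_i` and `φ_jᵀ S₂ φ_i` for `i ≠ j`, and such off-diagonal values at
`k` nodes determine both matrices. Optimality of the bandwidth is a cut-set count followed by
averaging over helpers.

The core is the nonsingularity of the system for the cross terms. For Vandermonde rows, inverting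
`Ψ_{H_i}` is Lagrange interpolation, so each coefficient is an integer polynomial in the points
divided by a quantity that depends only on its column (`crossCoeff_mul_eval`). Clearing these
denominators turns the determinant into an integer polynomial in the points. It remains to see that
it is not the zero polynomial in any characteristic; degrees then give a bound `q₀` for all fields
and all node lists at once.

For this, work over an algebraic closure and let the `α + r` helper points, `r = α + 1 - e`, be the
roots of `1 + X ^ (α + r)`. The interpolation polynomial becomes `N + X ^ α (X ^ r N)`, where `N`
vanishes at every failed point other than the two it omits. The system then couples only `s_{i,j}`
with `s_{j,i}`, and up to nonzero factors each 2 × 2 block has determinant `(z_i ^ α - z_j ^ α)(z_i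
^ r - z_j ^ r)`. -/

/-! ### Cut-set bound and optimality of the bandwidth -/

section CutSet

variable {Msg F : Type*} [Finite F] [Nontrivial F] {n α k : ℕ} {C : Msg → Fin n → Fin α → F}

/-- Cut-set bound: the helpers outside a set `R` of helpers which completes the failed nodes to
`k` nodes send at least as many symbols as the failed nodes store. -/
theorem ExactRepair.card_mul_le_sum_compl (hC : Reconstructs C k)
    (hMsg : Nat.card Msg = Nat.card F ^ (k * α)) {E H : Finset (Fin n)} (hEH : Disjoint E H)
    {b : H → ℕ} (r : ExactRepair C E H b) (R : Finset H) (hR : R.card + E.card = k) :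
    E.card * α ≤ ∑ h ∈ Rᶜ, b h := by
  classical
  -- The contents of `R` and the symbols sent by the other helpers determine the failed nodes, hence
  -- `k` nodes, hence the message; the bound comes from counting.
  let f : Msg → ((R → Fin α → F) × (∀ h : (Rᶜ : Finset H), Fin (b h) → F)) :=
    fun m => (fun h => C m h.1, fun h => r.send h.1 (C m h.1))
  have hf : Function.Injective f := by
    intro m m' h
    have h1 : ∀ h : H, h ∈ R → C m h = C m' h := fun h' hh =>
      congrFun (congrArg Prod.fst h) ⟨h', hh⟩
    have h2 : ∀ h : H, r.send h (C m h) = r.send h (C m' h) := by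
      intro h'
      by_cases hh : h' ∈ R
      · rw [h1 h' hh]
      · exact congrFun (congrArg Prod.snd h) ⟨h', Finset.mem_compl.2 hh⟩
    have h3 : ∀ i : E, C m i = C m' i := by
      intro i
      rw [← r.correct m i, ← r.correct m' i]
      congr 1
      exact funext h2
    apply hC (E ∪ R.map (Function.Embedding.subtype _))
    · rw [Finset.card_union_of_disjoint, Finset.card_map]
      · omega
      · rw [Finset.disjoint_left]
        intro a ha ha'
        obtain ⟨x, -, rfl⟩ := Finset.mem_map.1 ha'
        exact Finset.disjoint_left.1 hEH ha x.2
    · intro i hi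
      rcases Finset.mem_union.1 hi with hi | hi
      · exact h3 ⟨i, hi⟩
      · obtain ⟨x, hx, rfl⟩ := Finset.mem_map.1 hi
        exact h1 x hx
  have hcard := Nat.card_le_card_of_injective f hf
  have e1 : Nat.card (∀ h : (Rᶜ : Finset H), Fin (b h) → F) = Nat.card F ^ ∑ h ∈ Rᶜ, b h := by
    simp only [Nat.card_pi, Fintype.card_fin, Finset.prod_const, Finset.card_univ]
    rw [Finset.prod_pow_eq_pow_sum, ← Finset.sum_coe_sort Rᶜ b]
  have e2 : Nat.card (R → Fin α → F) = (Nat.card F ^ α) ^ R.card := by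
    simp [Nat.card_pi]
  rw [hMsg, Nat.card_prod, e1, e2] at hcard
  rw [← pow_mul, ← pow_add] at hcard
  have := (Nat.pow_le_pow_iff_right Finite.one_lt_card).1 hcard
  rw [← hR] at this
  nlinarith

/-- If any `α` of the values of `b` have sum at least `e α`, then all of them together have sum at
least `e` times their number. -/
theorem card_mul_le_sum_of_card_eq {ι : Type*} [Fintype ι] [DecidableEq ι] {α e : ℕ}
    (hα : 0 < α) (hι : α ≤ Fintype.card ι) (b : ι → ℕ)
    (h : ∀ T : Finset ι, T.card = α → e * α ≤ ∑ i ∈ T, b i) :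
    Fintype.card ι * e ≤ ∑ i, b i := by
  -- Fewer than `α` indices lie below `e`, so one `α`-set `T` absorbs them all: `T` is bounded by
  -- hypothesis, and its complement termwise.
  set S : Finset ι := Finset.univ.filter fun i => b i < e with hS
  have hSα : S.card < α := by
    by_contra! hc
    obtain ⟨T, hTS, hT⟩ := Finset.exists_subset_card_eq hc
    have h1 : ∑ i ∈ T, b i < ∑ i ∈ T, e :=
      Finset.sum_lt_sum_of_nonempty (Finset.card_pos.1 (by omega))
        fun i hi => (Finset.mem_filter.1 (hTS hi)).2
    have h2 := h T hT
    rw [Finset.sum_const, hT, smul_eq_mul, mul_comm] at h1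
    omega
  obtain ⟨T, hST, -, hT⟩ := Finset.exists_subsuperset_card_eq S.subset_univ hSα.le
    (by simpa using hι)
  have h1 : ∑ i ∈ Tᶜ, e ≤ ∑ i ∈ Tᶜ, b i := by
    refine Finset.sum_le_sum fun i hi => ?_
    by_contra! hc
    exact Finset.mem_compl.1 hi (hST (by simp [hS, hc]))
  rw [Finset.sum_const, Finset.card_compl, hT, smul_eq_mul] at h1
  rw [← Finset.sum_add_sum_compl T]
  have h2 := h T hT
  obtain ⟨c, hc⟩ := Nat.exists_eq_add_of_le hι
  rw [hc] at h1 ⊢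
  rw [Nat.add_sub_cancel_left] at h1
  nlinarith

end CutSet

/-! ### Reconstruction from `k` nodes -/

section ProductMatrixCode

variable {F : Type*} [Field F] {n α : ℕ}

theorem card_pmMessage (α : ℕ) (F : Type*) [Finite F] :
    Nat.card (PMMessage α F) = Nat.card F ^ ((α + 1) * α) := by
  rw [Nat.card_prod, Nat.card_fun, ← pow_add]
  congr 1
  rw [Nat.card_eq_fintype_card, Sym2.card, Fintype.card_fin, Nat.choose_two_right,
    Nat.add_sub_cancel]
  have := Nat.div_mul_cancel (even_iff_two_dvd.1 (Nat.even_mul_succ_self α))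
  rw [mul_comm α (α + 1)] at this
  omega

theorem symMatrix_isSymm {F : Type*} (x : Sym2 (Fin α) → F) : (symMatrix x).IsSymm := by
  ext i j
  simp [symMatrix, Sym2.eq_swap]

theorem symMatrix_injective {F : Type*} :
    Function.Injective (symMatrix : (Sym2 (Fin α) → F) → Matrix (Fin α) (Fin α) F) := by
  intro x y h
  ext p
  induction p with
  | h i j => exact congrFun (congrFun h i) j

variable (Φ : Matrix (Fin n) (Fin α) F) (L : Fin n → F)

theorem pmCode_eq (m : PMMessage α F) (i : Fin n) :
    pmCode Φ L m i = symMatrix m.1 *ᵥ Φ i + L i • symMatrix m.2 *ᵥ Φ i := by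
  have h1 : (diagonal L * Φ * symMatrix m.2) i = L i • (Φ i ᵥ* symMatrix m.2) := by
    rw [Matrix.mul_assoc]
    ext c
    rw [diagonal_mul]
    rfl
  have h2 : (Φ * symMatrix m.1) i = Φ i ᵥ* symMatrix m.1 := rfl
  have h3 : pmCode Φ L m i = (Φ * symMatrix m.1) i + (diagonal L * Φ * symMatrix m.2) i := by
    rw [pmCode, encodingMatrix, messageMatrix, fromCols_mul_fromRows]
    rfl
  rw [h3, h1, h2, ← mulVec_transpose, ← mulVec_transpose, symMatrix_isSymm, symMatrix_isSymm]

theorem eq_zero_of_dotProduct_eq_zero {s : Finset (Fin n)} (hs : s.card = α)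
    (h : LinearIndependent F fun i : s => Φ i) {w : Fin α → F} (hw : ∀ i ∈ s, Φ i ⬝ᵥ w = 0) :
    w = 0 := by
  have hspan := h.span_eq_top_of_card_eq_finrank' (by simp [hs])
  rw [← dotProduct_eq_zero_iff]
  intro u
  have hu : u ∈ Submodule.span F (Set.range fun i : s => Φ i) := hspan ▸ Submodule.mem_top
  rw [dotProduct_comm]
  induction hu using Submodule.span_induction with
  | mem x hx => obtain ⟨i, rfl⟩ := hx; exact hw i i.2
  | zero => simp
  | add x y _ _ hx hy => rw [add_dotProduct, hx, hy, add_zero]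
  | smul a x _ hx => rw [smul_dotProduct, hx, smul_zero]

theorem dotProduct_mulVec_symMatrix (x : Sym2 (Fin α) → F) (u w : Fin α → F) :
    u ⬝ᵥ symMatrix x *ᵥ w = w ⬝ᵥ symMatrix x *ᵥ u := by
  rw [dotProduct_mulVec, ← mulVec_transpose, symMatrix_isSymm, dotProduct_comm]

/-- A symmetric matrix vanishes if its bilinear form vanishes on all pairs of different vectors
of a family of `α + 1` vectors in general position. -/
theorem eq_zero_of_offDiag (hΦ : ∀ s : Finset (Fin n), s.card = α →
      LinearIndependent F fun i : s => Φ i) {K : Finset (Fin n)} (hK : K.card = α + 1)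
    (x : Sym2 (Fin α) → F)
    (h : ∀ i ∈ K, ∀ j ∈ K, i ≠ j → Φ j ⬝ᵥ symMatrix x *ᵥ Φ i = 0) : x = 0 := by
  -- The `α` vectors `Φ j` with `j ∈ K`, `j ≠ i`, already span, so the diagonal values are not
  -- needed.
  have h1 : ∀ i ∈ K, symMatrix x *ᵥ Φ i = 0 := by
    intro i hi
    have hc : (K.erase i).card = α := by rw [Finset.card_erase_of_mem hi, hK]; rfl
    exact eq_zero_of_dotProduct_eq_zero Φ hc (hΦ _ hc) fun j hj =>
      h i hi j (Finset.mem_of_mem_erase hj) (Finset.ne_of_mem_erase hj).symm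
  obtain ⟨T, hTK, hT⟩ := Finset.exists_subset_card_eq (show α ≤ K.card by omega)
  apply symMatrix_injective
  ext c d
  have h2 : symMatrix x c = 0 := by
    refine eq_zero_of_dotProduct_eq_zero Φ hT (hΦ _ hT) fun i hi => ?_
    rw [dotProduct_comm]
    exact congrFun (h1 i (hTK hi)) c
  rw [h2]
  rfl

/-- For `i ≠ j`, symmetry makes the two products between nodes `i` and `j` a 2 × 2 system in the
values of the two bilinear forms, with determinant `± (L i - L j)`. -/
theorem IsPMEncoding.reconstructs {Φ : Matrix (Fin n) (Fin α) F} {L : Fin n → F}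
    (h : IsPMEncoding Φ L) : Reconstructs (pmCode Φ L) (α + 1) := by
  intro K hK m m' hm
  have key : ∀ i ∈ K, ∀ j ∈ K, i ≠ j →
      Φ j ⬝ᵥ symMatrix (m.1 - m'.1) *ᵥ Φ i = 0 ∧ Φ j ⬝ᵥ symMatrix (m.2 - m'.2) *ᵥ Φ i = 0 := by
    have hsub : ∀ x y : Sym2 (Fin α) → F, symMatrix (x - y) = symMatrix x - symMatrix y :=
      fun x y => rfl
    have h1 : ∀ i ∈ K, ∀ j, Φ j ⬝ᵥ symMatrix (m.1 - m'.1) *ᵥ Φ i +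
        L i * Φ j ⬝ᵥ symMatrix (m.2 - m'.2) *ᵥ Φ i = 0 := by
      intro i hi j
      have := congrArg (Φ j ⬝ᵥ ·) (hm i hi)
      simp only [pmCode_eq, dotProduct_add, dotProduct_smul, smul_eq_mul] at this
      simp only [hsub, sub_mulVec, dotProduct_sub]
      linear_combination this
    intro i hi j hj hij
    have e1 := h1 i hi j
    have e2 := h1 j hj i
    rw [dotProduct_mulVec_symMatrix (m.1 - m'.1) (Φ i),
      dotProduct_mulVec_symMatrix (m.2 - m'.2) (Φ i)] at e2
    have hL : L i - L j ≠ 0 := sub_ne_zero.2 fun hc => hij (h.lambda_injective hc)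
    have e3 : Φ j ⬝ᵥ symMatrix (m.2 - m'.2) *ᵥ Φ i = 0 := by
      apply (mul_eq_zero.1 _).resolve_left hL
      linear_combination e1 - e2
    refine ⟨?_, e3⟩
    simpa [e3] using e1
  refine Prod.ext (sub_eq_zero.1 ?_) (sub_eq_zero.1 ?_)
  · exact eq_zero_of_offDiag Φ h.phi_rows hK _ fun i hi j hj hij => (key i hi j hj hij).1
  · exact eq_zero_of_offDiag Φ h.phi_rows hK _ fun i hi j hj hij => (key i hi j hj hij).2

end ProductMatrixCode

/-! ### Single-erasure repair and the system for the cross terms -/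

section Repair

variable {F : Type*} [Field F] {n α : ℕ} {Φ : Matrix (Fin n) (Fin α) F} {L : Fin n → F}

theorem isUnit_helperRows (h : IsPMEncoding Φ L) (v : Fin (α + α + 1) ↪ Fin n)
    (i : Fin (α + α + 1)) : IsUnit (helperRows Φ L v i) := by
  rw [← linearIndependent_rows_iff_isUnit]
  let g : Fin α ⊕ Fin α → Fin n := fun r => v (i.succAbove (finSumFinEquiv r))
  have hg : Function.Injective g :=
    v.injective.comp (Fin.succAbove_right_injective.comp finSumFinEquiv.injective)
  have hs : (Finset.univ.map ⟨g, hg⟩).card = 2 * α := by simp [two_mul]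
  exact (h.psi_rows _ hs).comp (fun r => ⟨g r, by simp⟩) fun a b hab => hg (congrArg Subtype.val hab)

theorem pmDecode_congr (v : Fin (α + α + 1) → Fin n) (i : Fin (α + α + 1))
    {s s' : Fin (α + α + 1) → F} (hs : ∀ l, l ≠ i → s l = s' l) :
    pmDecode Φ L v i s = pmDecode Φ L v i s' := by
  unfold pmDecode
  congr 2
  funext r
  exact hs _ (Fin.succAbove_ne _ _)

/-- If the symbols `s l`, `l ≠ i`, are the products of the rows of `Ψ` with `u`, then single-erasure
repair returns `[I, λ_i I] u`. -/
theorem pmDecode_eq_of_rows (h : IsPMEncoding Φ L) (v : Fin (α + α + 1) ↪ Fin n)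
    (i : Fin (α + α + 1)) {s : Fin (α + α + 1) → F} (u : Fin α ⊕ Fin α → F)
    (hs : ∀ l, l ≠ i → s l = encodingMatrix Φ L (v l) ⬝ᵥ u) :
    pmDecode Φ L v i s = u ∘ Sum.inl + L (v i) • u ∘ Sum.inr := by
  have h1 : (fun r => s (i.succAbove (finSumFinEquiv r))) = helperRows Φ L v i *ᵥ u := by
    funext r
    rw [hs _ (Fin.succAbove_ne _ _)]
    rfl
  have h2 := (Matrix.isUnit_iff_isUnit_det _).1 (isUnit_helperRows h v i)
  rw [pmDecode, h1, mulVec_mulVec u, nonsing_inv_mul _ h2, one_mulVec, fromCols_mulVec, one_mulVec,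
    smul_mulVec, one_mulVec]

theorem encodingMatrix_dotProduct (i : Fin n) (u : Fin α ⊕ Fin α → F) :
    encodingMatrix Φ L i ⬝ᵥ u = Φ i ⬝ᵥ (u ∘ Sum.inl) + L i * Φ i ⬝ᵥ (u ∘ Sum.inr) := by
  simp only [dotProduct, encodingMatrix, Fintype.sum_sum_type, fromCols_apply_inl,
    fromCols_apply_inr, diagonal_mul, Function.comp_apply, Finset.mul_sum, mul_assoc]

/-- Exact single-erasure repair. -/
theorem pmDecode_pmCode (h : IsPMEncoding Φ L) (v : Fin (α + α + 1) ↪ Fin n)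
    (m : PMMessage α F) (i : Fin (α + α + 1)) :
    pmDecode Φ L v i (fun l => pmCode Φ L m (v l) ⬝ᵥ Φ (v i)) = pmCode Φ L m (v i) := by
  rw [pmDecode_eq_of_rows h v i
    (Sum.elim (symMatrix m.1 *ᵥ Φ (v i)) (symMatrix m.2 *ᵥ Φ (v i)))]
  · rw [pmCode_eq]
    rfl
  · intro l _
    rw [encodingMatrix_dotProduct, pmCode_eq, add_dotProduct, smul_dotProduct, Sum.elim_comp_inl,
      Sum.elim_comp_inr, dotProduct_mulVec_symMatrix, dotProduct_mulVec_symMatrix m.2,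
      dotProduct_comm, dotProduct_comm (symMatrix m.2 *ᵥ _), smul_eq_mul]

theorem pmDecode_add (v : Fin (α + α + 1) → Fin n) (i : Fin (α + α + 1))
    (s s' : Fin (α + α + 1) → F) :
    pmDecode Φ L v i (s + s') = pmDecode Φ L v i s + pmDecode Φ L v i s' := by
  simp only [pmDecode, ← mulVec_add]
  rfl

theorem pmDecode_smul (v : Fin (α + α + 1) → Fin n) (i : Fin (α + α + 1)) (a : F)
    (s : Fin (α + α + 1) → F) : pmDecode Φ L v i (a • s) = a • pmDecode Φ L v i s := by
  simp only [pmDecode, ← mulVec_smul]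
  rfl

/-- The single-erasure repair as a linear map. -/
noncomputable def pmDecodeLinear (Φ : Matrix (Fin n) (Fin α) F) (L : Fin n → F)
    (v : Fin (α + α + 1) → Fin n) (i : Fin (α + α + 1)) :
    (Fin (α + α + 1) → F) →ₗ[F] (Fin α → F) where
  toFun := pmDecode Φ L v i
  map_add' := pmDecode_add v i
  map_smul' := pmDecode_smul v i

theorem dotProduct_pmDecode (v : Fin (α + α + 1) → Fin n) (i j : Fin (α + α + 1))
    (s : Fin (α + α + 1) → F) :
    Φ (v j) ⬝ᵥ pmDecode Φ L v i s = ∑ l, crossCoeff Φ L v i j l * s l := by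
  have h1 : pmDecode Φ L v i s = ∑ l, s l • pmDecode Φ L v i (Pi.single l 1) := by
    change pmDecodeLinear Φ L v i s = ∑ l, s l • pmDecodeLinear Φ L v i (Pi.single l 1)
    conv_lhs => rw [pi_eq_sum_univ' s, map_sum]
    simp only [map_smul]
  rw [h1, dotProduct_sum]
  refine Finset.sum_congr rfl fun l _ => ?_
  rw [dotProduct_smul, smul_eq_mul, mul_comm, crossCoeff]

/-- The decoder ignores the entry at `i`. Hence sums over `l ≠ i` may be taken over all `l`. -/
theorem crossCoeff_self (v : Fin (α + α + 1) → Fin n) (i j : Fin (α + α + 1)) :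
    crossCoeff Φ L v i j i = 0 := by
  have h1 : pmDecode Φ L v i (Pi.single i 1) = pmDecode Φ L v i 0 :=
    pmDecode_congr v i fun l hl => by simp [hl]
  have h2 : pmDecode Φ L v i 0 = 0 := map_zero (pmDecodeLinear Φ L v i)
  rw [crossCoeff, h1, h2, dotProduct_zero]

/-- A sum over all positions splits into failed positions and helpers. -/
theorem sum_failedPos_add_sum_helperPos {e : ℕ} (f : Fin (α + α + 1) → F) :
    ∑ l, f l = ∑ l : FailedPos α e, f l + ∑ l : HelperPos α e, f l := by
  classical
  rw [← Fintype.sum_subtype_add_sum_subtype (fun l : Fin (α + α + 1) => l.val < e) f]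
  congr 1
  exact Fintype.sum_equiv (Equiv.subtypeEquivRight fun l => not_lt) _ _ fun _ => rfl

theorem sum_offDiag_ite {ι : Type*} [Fintype ι] [DecidableEq ι] (i : ι) (g : ι → F)
    (hg : g i = 0) :
    (∑ q : {p : ι × ι // p.1 ≠ p.2}, if q.1.2 = i then g q.1.1 else 0) = ∑ l, g l := by
  rw [← Finset.sum_subtype (Finset.univ.filter fun p : ι × ι => p.1 ≠ p.2) (by simp)
    (fun p => if p.2 = i then g p.1 else 0), Finset.sum_filter, Fintype.sum_prod_type]
  refine Finset.sum_congr rfl fun l _ => ?_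
  rw [Finset.sum_eq_single i (fun m _ hm => by simp [hm]) (by simp)]
  by_cases hl : l = i
  · simp [hl, hg]
  · simp [hl]

theorem repairMatrix_mulVec_apply (v : Fin (α + α + 1) → Fin n) {e : ℕ}
    (t : FailedPos α e → FailedPos α e → F) (p : CrossPair α e) :
    (repairMatrix Φ L v e *ᵥ fun q => t q.1.1 q.1.2) p =
      -t p.1.1 p.1.2 + ∑ l : FailedPos α e, crossCoeff Φ L v p.1.1 p.1.2 l * t l p.1.1 := by
  classical
  obtain ⟨⟨i, j⟩, hij⟩ := p
  dsimp only at hij ⊢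
  -- The two nonzero cases exclude each other: `q = p` would give `q.1.2 = j ≠ i`. So each entry is
  -- a sum of two independent indicators.
  have h1 : ∀ q : CrossPair α e, repairMatrix Φ L v e ⟨(i, j), hij⟩ q * t q.1.1 q.1.2 =
      (if q = ⟨(i, j), hij⟩ then -t i j else 0) +
        if q.1.2 = i then crossCoeff Φ L v i j q.1.1 * t q.1.1 i else 0 := by
    intro q
    simp only [repairMatrix, of_apply]
    by_cases hq : q = ⟨(i, j), hij⟩
    · subst hq
      simp [hij.symm]
    · rw [if_neg hq, if_neg hq]
      by_cases hq2 : q.1.2 = i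
      · simp [hq2]
      · simp [hq2]
  rw [mulVec, dotProduct, Finset.sum_congr rfl fun q _ => h1 q, Finset.sum_add_distrib,
    Finset.sum_ite_eq' Finset.univ, if_pos (Finset.mem_univ _)]
  congr 1
  exact sum_offDiag_ite i (fun l : FailedPos α e => crossCoeff Φ L v i j l * t l i)
    (by rw [crossCoeff_self, zero_mul])

/-- The true cross terms satisfy the system, by exactness of single-erasure repair; nonsingularity
makes them its only solution. -/
theorem pmRepair_pmDownload (h : IsPMEncoding Φ L) (v : Fin (α + α + 1) ↪ Fin n) {e : ℕ}
    (hdet : (repairMatrix Φ L v e).det ≠ 0) (m : PMMessage α F) (i : FailedPos α e) :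
    pmRepair Φ L v e (pmDownload Φ L v e m) i = pmCode Φ L m (v i) := by
  have h1 : (repairMatrix Φ L v e *ᵥ fun q => pmCode Φ L m (v q.1.1) ⬝ᵥ Φ (v q.1.2)) =
      repairRhs Φ L v e (pmDownload Φ L v e m) := by
    funext p
    rw [repairMatrix_mulVec_apply v
      (fun i j : FailedPos α e => pmCode Φ L m (v i) ⬝ᵥ Φ (v j)) p]
    have h2 := dotProduct_pmDecode (Φ := Φ) (L := L) v p.1.1 p.1.2
      (fun l => pmCode Φ L m (v l) ⬝ᵥ Φ (v p.1.1))
    rw [pmDecode_pmCode h, dotProduct_comm, sum_failedPos_add_sum_helperPos (e := e)] at h2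
    rw [h2, repairRhs]
    simp only [pmDownload]
    ring
  rw [pmRepair, ← h1, mulVec_mulVec, nonsing_inv_mul _ (isUnit_iff_ne_zero.2 hdet), one_mulVec,
    ← pmDecode_pmCode h v m i]
  refine pmDecode_congr v i fun l hl => ?_
  by_cases hle : l.val < e
  · have hne : (⟨l, hle⟩ : FailedPos α e) ≠ i := fun hc => hl (congrArg Subtype.val hc)
    simp only [hle, hne, dif_pos, ne_eq, not_false_eq_true]
  · simp only [hle, dif_neg, not_false_eq_true, pmDownload]

/-- The product-matrix code is exactly repaired by solving the linear system for the cross terms,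
if that system is nonsingular for all lists of nodes. -/
theorem IsPMEncoding.nonempty_exactRepair (h : IsPMEncoding Φ L) {e d : ℕ}
    (hed : e + d = α + α + 1)
    (hdet : ∀ v : Fin (α + α + 1) ↪ Fin n, (repairMatrix Φ L v e).det ≠ 0)
    {E H : Finset (Fin n)} (hE : E.card = e) (hH : H.card = d) (hEH : Disjoint E H) :
    Nonempty (ExactRepair (pmCode Φ L) E H fun _ => e) := by
  classical
  let fE : Fin e ≃ E := (E.equivFinOfCardEq hE).symm
  let fH : Fin d ≃ H := (H.equivFinOfCardEq hH).symm
  let c : Fin (α + α + 1) ≃ Fin e ⊕ Fin d := (finCongr hed.symm).trans finSumFinEquiv.symm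
  let g : Fin e ⊕ Fin d → Fin n := Sum.elim (fun a => fE a) fun a => fH a
  have hg : Function.Injective g :=
    (Subtype.val_injective.comp fE.injective).sumElim (Subtype.val_injective.comp fH.injective)
      fun a b (hab : (fE a : Fin n) = fH b) =>
        Finset.disjoint_left.1 hEH (fE a).2 (hab.symm ▸ (fH b).2)
  let v : Fin (α + α + 1) ↪ Fin n := ⟨g ∘ c, hg.comp c.injective⟩
  let pE : Fin e → FailedPos α e := fun a => ⟨⟨a, by omega⟩, a.2⟩
  have hvE : ∀ i : FailedPos α e, v i = fE ⟨i.1, i.2⟩ := by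
    intro i
    have : c i = Sum.inl ⟨i.1, i.2⟩ := by
      apply finSumFinEquiv.injective
      ext
      simp [c]
    simp [v, g, this]
  have hvH : ∀ l : HelperPos α e, ∃ a : Fin d, v l = fH a := by
    intro l
    refine ⟨⟨l.1 - e, by omega⟩, ?_⟩
    have : c l = Sum.inr ⟨l.1 - e, by omega⟩ := by
      apply finSumFinEquiv.injective
      ext
      simp [c, l.2]
    simp [v, g, this]
  choose a ha using hvH
  refine ⟨⟨fun h w t => w ⬝ᵥ Φ (fE t),
    fun y i => pmRepair Φ L v e (fun l j => y (fH (a l)) ⟨j.1, j.2⟩) (pE (fE.symm i)), ?_⟩⟩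
  intro m i
  have h1 : (fun (l : HelperPos α e) (j : FailedPos α e) =>
      pmCode Φ L m (fH (a l)) ⬝ᵥ Φ (fE ⟨j.1, j.2⟩)) = pmDownload Φ L v e m := by
    funext l j
    rw [pmDownload, ha, hvE]
  dsimp only
  rw [h1, pmRepair_pmDownload h v (hdet v), hvE]
  simp [pE]

end Repair

/-! ### The Vandermonde encoding -/

section Vandermonde

variable {F : Type*} [Field F] {n α : ℕ} {x : Fin n → F}

theorem vandermonde_encodingMatrix_apply (i : Fin n) (r : Fin α ⊕ Fin α) :
    encodingMatrix (vandermondePhi α x) (fun i => x i ^ α) i r =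
      x i ^ (finSumFinEquiv r : ℕ) := by
  rcases r with c | c
  · simp [encodingMatrix, vandermondePhi]
  · simp [encodingMatrix, vandermondePhi, diagonal_mul, pow_add, mul_comm]

theorem linearIndependent_pow_rows (hx : Function.Injective x) (N : ℕ) (s : Finset (Fin n))
    (hs : s.card = N) : LinearIndependent F fun (i : s) (c : Fin N) => x i ^ (c : ℕ) := by
  let f : Fin N ≃ s := (s.equivFinOfCardEq hs).symm
  have h1 : IsUnit (vandermonde fun a => x (f a)) := by
    rw [Matrix.isUnit_iff_isUnit_det, isUnit_iff_ne_zero, det_vandermonde_ne_zero_iff]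
    exact hx.comp (Subtype.val_injective.comp f.injective)
  rw [← linearIndependent_rows_iff_isUnit] at h1
  exact (linearIndependent_equiv f).1 h1

theorem isPMEncoding_vandermondePhi (hx : Function.Injective fun i => x i ^ α) :
    IsPMEncoding (vandermondePhi α x) fun i => x i ^ α := by
  have hx' : Function.Injective x := fun i j hij => hx (by simp [hij])
  refine ⟨fun s hs => ?_, fun s hs => linearIndependent_pow_rows hx' α s hs, hx⟩
  have h1 := linearIndependent_pow_rows hx' (α + α) s (by omega)
  have h2 := h1.map' (LinearEquiv.funCongrLeft F F finSumFinEquiv).toLinearMap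
    (LinearEquiv.ker _)
  have h3 : (fun i : s => encodingMatrix (vandermondePhi α x) (fun i => x i ^ α) i) =
      LinearEquiv.funCongrLeft F F finSumFinEquiv ∘
        fun (i : s) (c : Fin (α + α)) => x i ^ (c : ℕ) := by
    funext i r
    exact vandermonde_encodingMatrix_apply _ _
  rw [h3]
  exact h2

end Vandermonde

/-! ### Clearing denominators -/

section Cleared

open Polynomial

variable {R : Type*} [CommRing R] {α : ℕ}

/-- The monic polynomial whose roots are the points `z m` with `m ≠ i` and `m ≠ l`. -/
noncomputable def nodePoly {ι : Type*} [Fintype ι] [DecidableEq ι] (z : ι → R) (i l : ι) : R[X] :=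
  ∏ m with m ≠ i ∧ m ≠ l, (X - C (z m))

/-- For `U = P + X ^ α Q` with `P` and `Q` of degree less than `α`, the value `P(b) + a Q(b)`. -/
noncomputable def twistedEval (α : ℕ) (a b : R) (U : R[X]) : R :=
  ∑ c : Fin α, (U.coeff c + a * U.coeff (α + c)) * b ^ (c : ℕ)

/-- The matrix of the system for the cross terms with the denominators in its columns cleared. -/
noncomputable def clearedMatrix (e : ℕ) (z : Fin (α + α + 1) → R) :
    Matrix (CrossPair α e) (CrossPair α e) R :=
  Matrix.of fun p q =>
    if q = p then -(nodePoly z q.1.2.1 q.1.1.1).eval (z q.1.1)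
    else if q.1.2 = p.1.1 then
      twistedEval α (z p.1.1 ^ α) (z p.1.2) (nodePoly z q.1.2.1 q.1.1.1)
    else 0

theorem map_nodePoly {S : Type*} [CommRing S] (f : R →+* S) {ι : Type*} [Fintype ι]
    [DecidableEq ι] (z : ι → R) (i l : ι) :
    (nodePoly z i l).map f = nodePoly (f ∘ z) i l := by
  simp [nodePoly, Polynomial.map_prod]

theorem map_twistedEval {S : Type*} [CommRing S] (f : R →+* S) (a b : R) (U : R[X]) :
    f (twistedEval α a b U) = twistedEval α (f a) (f b) (U.map f) := by
  simp [twistedEval]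

/-- Compatibility with ring homomorphisms lets one integer determinant polynomial specialize to
every field. -/
theorem map_clearedMatrix {S : Type*} [CommRing S] (f : R →+* S) (e : ℕ)
    (z : Fin (α + α + 1) → R) : (clearedMatrix e z).map f = clearedMatrix e (f ∘ z) := by
  ext p q
  simp only [clearedMatrix, map_apply, of_apply]
  split_ifs with h1 h2
  · rw [map_neg, ← Polynomial.eval_map_apply, map_nodePoly]
    rfl
  · rw [map_twistedEval, map_nodePoly, map_pow]
    rfl
  · exact map_zero f

theorem natDegree_nodePoly_lt [Nontrivial R] (z : Fin (α + α + 1) → R) {i l : Fin (α + α + 1)}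
    (hil : l ≠ i) : (nodePoly z i l).natDegree < α + α := by
  rw [nodePoly, natDegree_prod_of_monic _ _ fun m _ => monic_X_sub_C _]
  simp only [natDegree_X_sub_C, Finset.sum_const, smul_eq_mul, mul_one]
  have h1 : (Finset.univ.filter fun m => m ≠ i ∧ m ≠ l) = (Finset.univ.erase i).erase l := by
    ext m
    simp [and_comm]
  have h2 : i.1 ≠ l.1 := fun h => hil (Fin.ext h.symm)
  rw [h1, Finset.card_erase_of_mem (by simp [hil]), Finset.card_erase_of_mem (by simp)]
  simp
  omega

theorem eval_nodePoly_of_ne {ι : Type*} [Fintype ι] [DecidableEq ι] (z : ι → R) {i l m : ι}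
    (hi : m ≠ i) (hl : m ≠ l) : (nodePoly z i l).eval (z m) = 0 := by
  rw [nodePoly, eval_prod]
  exact Finset.prod_eq_zero (i := m) (by simp [hi, hl]) (by simp)

theorem eval_nodePoly_ne_zero [IsDomain R] {ι : Type*} [Fintype ι] [DecidableEq ι] {z : ι → R}
    (hz : Function.Injective z) (i l : ι) : (nodePoly z i l).eval (z l) ≠ 0 := by
  rw [nodePoly, eval_prod, Finset.prod_ne_zero_iff]
  intro m hm
  simp only [eval_sub, eval_X, eval_C]
  exact sub_ne_zero.2 fun h => (Finset.mem_filter.1 hm).2.2 (hz h.symm)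

end Cleared

/-! ### Repair coefficients by Lagrange interpolation -/

section ClearedRepair

open Polynomial

variable {F : Type*} [Field F] {n α : ℕ} {x : Fin n → F}

theorem crossCoeff_mul_eval (hx : Function.Injective fun i => x i ^ α)
    (v : Fin (α + α + 1) ↪ Fin n) {i l : Fin (α + α + 1)} (hil : l ≠ i) (j : Fin (α + α + 1)) :
    crossCoeff (vandermondePhi α x) (fun i => x i ^ α) v i j l *
        (nodePoly (x ∘ v) i l).eval (x (v l)) =
      twistedEval α (x (v i) ^ α) (x (v j)) (nodePoly (x ∘ v) i l) := by
  set N := nodePoly (x ∘ v) i l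
  -- The coefficient vector of `N`, of degree below `2 α`, solves the interpolation problem with
  -- value `N(x_l)` at `l` and `0` at the other nodes except `i`.
  have h1 := pmDecode_eq_of_rows (isPMEncoding_vandermondePhi hx) v i
    (s := N.eval (x (v l)) • Pi.single l (1 : F)) (fun r => N.coeff (finSumFinEquiv r)) (by
      intro m hm
      have h2 : encodingMatrix (vandermondePhi α x) (fun i => x i ^ α) (v m) ⬝ᵥ
          (fun r => N.coeff (finSumFinEquiv r)) = N.eval (x (v m)) := by
        rw [eval_eq_sum_range' (natDegree_nodePoly_lt _ hil), ← Fin.sum_univ_eq_sum_range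
          (fun c => N.coeff c * x (v m) ^ c), dotProduct]
        refine Fintype.sum_equiv finSumFinEquiv _ _ fun r => ?_
        rw [vandermonde_encodingMatrix_apply, mul_comm]
      rw [h2]
      by_cases hml : m = l
      · subst hml
        simp
      · rw [show N.eval (x (v m)) = 0 from eval_nodePoly_of_ne (x ∘ v) hm hml]
        simp [hml])
  rw [pmDecode_smul] at h1
  rw [crossCoeff, mul_comm, ← smul_eq_mul, ← dotProduct_smul, h1, twistedEval, dotProduct]
  refine Finset.sum_congr rfl fun c _ => ?_
  simp [vandermondePhi, mul_comm, add_comm α]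

/-- The Lagrange denominator of the coefficient of `s_{l,i}` does not depend on `j`, so it scales a
whole column. -/
theorem clearedMatrix_eq (hx : Function.Injective fun i => x i ^ α)
    (v : Fin (α + α + 1) ↪ Fin n) (e : ℕ) :
    clearedMatrix e (x ∘ v) = repairMatrix (vandermondePhi α x) (fun i => x i ^ α) v e *
      diagonal fun q => (nodePoly (x ∘ v) q.1.2.1 q.1.1.1).eval (x (v q.1.1)) := by
  ext p q
  rw [mul_diagonal]
  simp only [clearedMatrix, repairMatrix, of_apply]
  split_ifs with h1 h2
  · simp
  · rw [h2, crossCoeff_mul_eval hx v fun h => q.2 (Subtype.ext (h.trans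
      (congrArg Subtype.val h2.symm)))]
    rfl
  · simp

theorem det_repairMatrix_ne_zero (hx : Function.Injective fun i => x i ^ α)
    (v : Fin (α + α + 1) ↪ Fin n) {e : ℕ} (h : (clearedMatrix e (x ∘ v)).det ≠ 0) :
    (repairMatrix (vandermondePhi α x) (fun i => x i ^ α) v e).det ≠ 0 := by
  rw [clearedMatrix_eq hx, det_mul] at h
  exact left_ne_zero_of_mul h

end ClearedRepair

/-! ### A special point where the determinant is nonzero -/

section SpecialPoint

open Polynomial

theorem twistedEval_add_X_pow_mul {R : Type*} [CommRing R] {α : ℕ} (a b : R) {P Q : R[X]}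
    (hP : P.natDegree < α) (hQ : Q.natDegree < α) :
    twistedEval α a b (P + X ^ α * Q) = P.eval b + a * Q.eval b := by
  rw [eval_eq_sum_range' hP, eval_eq_sum_range' hQ, ← Fin.sum_univ_eq_sum_range
    (fun c => P.coeff c * b ^ c), ← Fin.sum_univ_eq_sum_range (fun c => Q.coeff c * b ^ c),
    Finset.mul_sum, ← Finset.sum_add_distrib, twistedEval]
  refine Finset.sum_congr rfl fun c _ => ?_
  rw [coeff_add, coeff_add, coeff_X_pow_mul', if_neg (not_le.2 c.2),
    coeff_eq_zero_of_natDegree_lt (show P.natDegree < α + c by omega), add_comm α (c : ℕ),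
    coeff_X_pow_mul]
  ring

variable {K : Type*} [Field K] {α e : ℕ}

theorem nodePoly_eq_mul_prod_helperPos (z : Fin (α + α + 1) → K) (i l : FailedPos α e) :
    nodePoly z i.1 l.1 =
      nodePoly (fun m : FailedPos α e => z m) i l * ∏ m : HelperPos α e, (X - C (z m)) := by
  classical
  simp only [nodePoly, Finset.prod_filter]
  rw [← Fintype.prod_subtype_mul_prod_subtype (fun l : Fin (α + α + 1) => l.val < e)]
  congr 1
  · refine Finset.prod_congr rfl fun m _ => ?_
    simp only [ne_eq, Subtype.ext_iff]
  · refine Fintype.prod_equiv (Equiv.subtypeEquivRight fun l => not_lt) _ _ fun m => ?_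
    rw [if_pos]
    · rfl
    · exact ⟨fun h => m.2 (h ▸ i.2), fun h => m.2 (h ▸ l.2)⟩

theorem natDegree_nodePoly_failedPos (z : FailedPos α e → K) (he : e ≤ α + α + 1)
    {i l : FailedPos α e} (hil : l ≠ i) : (nodePoly z i l).natDegree + 2 = e := by
  have hc : Fintype.card (FailedPos α e) = e := by
    rw [Fintype.card_subtype, Fin.card_filter_val_lt, min_eq_right he]
  rw [nodePoly, natDegree_prod_of_monic _ _ fun m _ => monic_X_sub_C _]
  simp only [natDegree_X_sub_C, Finset.sum_const, smul_eq_mul, mul_one]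
  have h1 : (Finset.univ.filter fun m => m ≠ i ∧ m ≠ l) = (Finset.univ.erase i).erase l := by
    ext m
    simp [and_comm]
  have h2 : i.1.1 ≠ l.1.1 := fun h => hil (Subtype.ext (Fin.ext h.symm))
  rw [h1, Finset.card_erase_of_mem (by simp [hil]), Finset.card_erase_of_mem (by simp),
    Finset.card_univ, hc]
  have := i.2
  have := l.2
  omega

/-- If the helper points are the roots of `1 + X ^ (α + r)`, the cleared system decouples into
blocks of size two. -/
theorem det_clearedMatrix_ne_zero {r : ℕ} (hr : α + r + e = α + α + 1) (heα : e ≤ α)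
    (z : Fin (α + α + 1) → K) (hz : ∏ m : HelperPos α e, (X - C (z m)) = 1 + X ^ (α + r))
    (hα : Function.Injective fun i : FailedPos α e => z i ^ α)
    (hr' : Function.Injective fun i : FailedPos α e => z i ^ r) :
    (clearedMatrix e z).det ≠ 0 := by
  have hzinj : Function.Injective fun i : FailedPos α e => z i :=
    fun i j hij => hα (congrArg (· ^ α) hij)
  let N : FailedPos α e → FailedPos α e → K[X] := nodePoly fun m : FailedPos α e => z m
  have htw : ∀ (a b : K) (i l : FailedPos α e), l ≠ i →
      twistedEval α a b (nodePoly z i.1 l.1) = (1 + a * b ^ r) * (N i l).eval b := by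
    intro a b i l hil
    have hdeg := natDegree_nodePoly_failedPos (fun m : FailedPos α e => z m) (by omega) hil
    -- Both halves have degree below `α`: `N i l` has degree `e - 2`, and `r + (e - 2) = α - 1`.
    have h1 : nodePoly z i.1 l.1 = N i l + X ^ α * (X ^ r * N i l) := by
      rw [nodePoly_eq_mul_prod_helperPos, hz]
      ring
    have h2 : (X ^ r * N i l).natDegree < α := by
      refine natDegree_mul_le.trans_lt ?_
      rw [natDegree_X_pow]
      change r + (N i l).natDegree < α
      change (N i l).natDegree + 2 = e at hdeg
      omega
    rw [h1, twistedEval_add_X_pow_mul a b (by change (N i l).natDegree + 2 = e at hdeg; omega) h2]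
    simp
    ring
  have hself : ∀ i j : FailedPos α e,
      (nodePoly z j.1 i.1).eval (z i) = (1 + z i ^ (α + r)) * (N j i).eval (z i) := by
    intro i j
    rw [nodePoly_eq_mul_prod_helperPos, hz]
    simp only [eval_mul, eval_add, eval_one, eval_pow, eval_X]
    ring
  rw [ne_eq, ← exists_mulVec_eq_zero_iff]
  rintro ⟨s, hs0, hs⟩
  apply hs0
  have hrow : ∀ (i j : FailedPos α e) (hij : i ≠ j),
      (1 + z i ^ (α + r)) * ((N j i).eval (z i) * s ⟨(i, j), hij⟩) =
        (1 + z i ^ α * z j ^ r) * ((N i j).eval (z j) * s ⟨(j, i), hij.symm⟩) := by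
    intro i j hij
    have h1 := congrFun hs ⟨(i, j), hij⟩
    have hne : (⟨(i, j), hij⟩ : CrossPair α e) ≠ ⟨(j, i), hij.symm⟩ := fun h =>
      hij (congrArg (fun p : CrossPair α e => p.1.1) h)
    rw [mulVec, dotProduct, Fintype.sum_eq_add _ _ hne] at h1
    · simp only [clearedMatrix, of_apply, if_true, if_neg hne.symm, Pi.zero_apply, hself,
        htw _ _ i j hij.symm] at h1
      linear_combination -h1
    -- In row `(i, j)`, a column `(l, i)` with `l ≠ j` drops out because `N i l` vanishes at `z j`.
    · rintro ⟨⟨l, m⟩, hlm⟩ ⟨hq1, hq2⟩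
      simp only [clearedMatrix, of_apply, if_neg hq1]
      dsimp only at hlm
      by_cases hm : m = i
      · subst hm
        have hlj : l ≠ j := fun h => hq2 (by subst h; rfl)
        rw [if_pos rfl, htw _ _ m l hlm]
        have : (N m l).eval (z j) = 0 :=
          eval_nodePoly_of_ne (fun m : FailedPos α e => z m) hij.symm hlj.symm
        rw [this, mul_zero, zero_mul]
      · rw [if_neg hm, zero_mul]
  funext ⟨⟨i, j⟩, hij⟩
  dsimp only at hij
  have h1 := hrow i j hij
  have h2 := hrow j i hij.symm
  have hN : (N j i).eval (z i) ≠ 0 := eval_nodePoly_ne_zero hzinj j i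
  have ha : z i ^ α - z j ^ α ≠ 0 := sub_ne_zero.2 fun h => hij (hα h)
  have hb : z i ^ r - z j ^ r ≠ 0 := sub_ne_zero.2 fun h => hij (hr' h)
  refine (mul_eq_zero.1 ?_).resolve_left (mul_ne_zero (mul_ne_zero ha hb) hN)
  rw [pow_add] at h1 h2
  -- Eliminates `s_{j,i}`; what is left is `(1 + a_i b_i)(1 + a_j b_j) - (1 + a_i b_j)(1 + a_j b_i)
  -- = (a_i - a_j)(b_i - b_j)` with `a = z ^ α`, `b = z ^ r`.
  linear_combination (1 + z j ^ α * z j ^ r) * h1 + (1 + z i ^ α * z j ^ r) * h2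

/-- Repeated roots are allowed: `1 + X ^ (α + r)` is inseparable when the characteristic divides `α
+ r`, and the cleared determinant does not need distinct helper points. -/
theorem exists_prod_X_sub_C_eq [IsAlgClosed K] {ι : Type*} [Fintype ι] {P : K[X]} (hP : P.Monic)
    (hι : P.natDegree = Fintype.card ι) : ∃ y : ι → K, ∏ i, (X - C (y i)) = P := by
  have hs := IsAlgClosed.splits P
  obtain ⟨l, hl⟩ := Quot.exists_rep P.roots
  have hlen : l.length = Fintype.card ι := by
    rw [← hι, hs.natDegree_eq_card_roots, ← hl]
    rfl
  let f : ι ≃ Fin l.length := (Fintype.equivFinOfCardEq hlen.symm)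
  refine ⟨fun i => l.get (f i), ?_⟩
  rw [Fintype.prod_equiv f _ (fun a => X - C (l.get a)) fun _ => rfl]
  conv_rhs => rw [hs.eq_prod_roots_of_monic hP, ← hl]
  simp [Fin.prod_univ_fun_getElem l fun a => X - C a]

theorem exists_pow_injective [IsAlgClosed K] {ι : Type*} [Finite ι] {N : ℕ} (hN : 0 < N) :
    ∃ g : ι → K, Function.Injective fun i => g i ^ N := by
  have := IsAlgClosed.instInfinite (K := K)
  cases nonempty_fintype ι
  let f : ι ↪ K :=
    ((Fintype.equivFin ι).toEmbedding.trans Fin.valEmbedding).trans (Infinite.natEmbedding K)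
  choose g hg using fun i => IsAlgClosed.exists_pow_nat_eq (f i) hN
  exact ⟨g, by simpa only [hg] using f.injective⟩

theorem exists_det_clearedMatrix_ne_zero (K : Type*) [Field K] [IsAlgClosed K] {α e : ℕ}
    (hα : 0 < α) (heα : e ≤ α) :
    ∃ z : Fin (α + α + 1) → K, (clearedMatrix e z).det ≠ 0 := by
  obtain ⟨r, hr⟩ : ∃ r, α + r + e = α + α + 1 := ⟨α + 1 - e, by omega⟩
  have hcard : Fintype.card (HelperPos α e) = α + r := by
    have h1 := Fintype.card_subtype_compl fun l : Fin (α + α + 1) => l.val < e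
    rw [Fintype.card_fin, Fintype.card_subtype, Fintype.card_subtype, Fin.card_filter_val_lt] at h1
    simp only [not_lt] at h1
    rw [Fintype.card_subtype, h1]
    omega
  obtain ⟨y, hy⟩ := exists_prod_X_sub_C_eq (ι := HelperPos α e) (P := (X ^ (α + r) + C 1 : K[X]))
    (monic_X_pow_add_C _ (by omega)) (by rw [natDegree_X_pow_add_C, hcard])
  -- Distinct `α * r`-th powers force both the `α`-th and the `r`-th powers to be distinct; `r` is
  -- positive as `e ≤ α`.
  obtain ⟨g, hg⟩ := exists_pow_injective (K := K) (ι := FailedPos α e)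
    (show 0 < α * r from Nat.mul_pos hα (by omega))
  refine ⟨fun l => if h : l.val < e then g ⟨l, h⟩ else y ⟨l, not_lt.1 h⟩,
    det_clearedMatrix_ne_zero hr heα _ ?_ ?_ ?_⟩
  · refine Eq.trans (Finset.prod_congr rfl fun m _ => ?_) (hy.trans (by rw [C_1, add_comm]))
    rw [dif_neg (not_lt.2 m.2)]
  · intro i j hij
    apply hg
    simp only [i.2, j.2, dif_pos] at hij
    simp only [pow_mul, hij]
  · intro i j hij
    apply hg
    simp only [i.2, j.2, dif_pos] at hij
    simp only [mul_comm α r, pow_mul, hij]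

end SpecialPoint

/-! ### From the special point to all large finite fields -/

section Generic

/-- Finitely many integer polynomials, each of which is not identically zero on an extension of the
finite field `F`, have a common point over `F` at which none of them vanishes, if `F` has more
elements than the sum of their degrees. -/
theorem MvPolynomial.exists_forall_aeval_ne_zero {n : ℕ} {F K : Type*} [Field F] [Fintype F]
    [Field K] [Algebra F K] {ι : Type*} [Fintype ι] (Q : ι → MvPolynomial (Fin n) ℤ)
    (hF : ∑ t, (Q t).totalDegree < Fintype.card F)
    (hQ : ∀ t, ∃ y : Fin n → K, MvPolynomial.aeval y (Q t) ≠ 0) :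
    ∃ x : Fin n → F, ∀ t, MvPolynomial.aeval x (Q t) ≠ 0 := by
  have h0 : ∀ t, map (algebraMap ℤ F) (Q t) ≠ 0 := by
    intro t ht
    obtain ⟨y, hy⟩ := hQ t
    rw [← aeval_map_algebraMap F, ht, map_zero] at hy
    exact hy rfl
  by_contra! hc
  refine (Finset.prod_ne_zero_iff (s := Finset.univ)).2 (fun t _ => h0 t) ?_
  -- A product of the reductions that vanishes on all of `F ^ n`, with degree below `|F|` in each
  -- variable, would be zero.
  refine eq_zero_of_eval_zero_at_prod_finset _ (fun _ => Finset.univ) (fun i => ?_) fun x _ => ?_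
  · rw [Finset.card_univ]
    refine ((degreeOf_le_totalDegree _ i).trans (totalDegree_finsetProd _ _)).trans_lt
      (lt_of_le_of_lt (Finset.sum_le_sum fun t _ => ?_) hF)
    exact Finset.sup_mono (support_map_subset _ _)
  · obtain ⟨t, ht⟩ := hc x
    rw [map_prod]
    refine Finset.prod_eq_zero (Finset.mem_univ t) ?_
    rw [← ht, ← aeval_map_algebraMap F x (Q t)]
    rfl

/-- The determinant of the cleared system for the nodes `v`, as a polynomial in the evaluation
points. -/
noncomputable def detPoly {n α : ℕ} (e : ℕ) (v : Fin (α + α + 1) ↪ Fin n) :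
    MvPolynomial (Fin n) ℤ :=
  (clearedMatrix e fun l => MvPolynomial.X (v l)).det

theorem aeval_detPoly {n α : ℕ} {K : Type*} [Field K] (e : ℕ) (v : Fin (α + α + 1) ↪ Fin n)
    (y : Fin n → K) : MvPolynomial.aeval y (detPoly e v) = (clearedMatrix e (y ∘ v)).det := by
  have h1 := map_clearedMatrix (MvPolynomial.aeval (R := ℤ) y).toRingHom e
    (fun l : Fin (α + α + 1) => MvPolynomial.X (v l))
  have h2 : ((MvPolynomial.aeval (R := ℤ) y).toRingHom : MvPolynomial (Fin n) ℤ → K) ∘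
      (fun l : Fin (α + α + 1) => MvPolynomial.X (v l)) = y ∘ v := by
    funext l
    exact MvPolynomial.aeval_X y (v l)
  rw [h2] at h1
  rw [← h1, detPoly]
  exact RingHom.map_det (MvPolynomial.aeval (R := ℤ) y).toRingHom _

/-- Over every sufficiently large finite field there are evaluation points with different
`α`-th powers for which all the cleared systems are nonsingular. -/
theorem exists_evaluation_points (n : ℕ) {α e : ℕ} (hα : 0 < α) (heα : e ≤ α) :
    ∃ q₀ : ℕ, ∀ (F : Type*) [Field F] [Fintype F], q₀ ≤ Fintype.card F →
      ∃ x : Fin n → F, (Function.Injective fun i => x i ^ α) ∧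
        ∀ v : Fin (α + α + 1) ↪ Fin n, (clearedMatrix e (x ∘ v)).det ≠ 0 := by
  classical
  let Q : {p : Fin n × Fin n // p.1 ≠ p.2} ⊕ (Fin (α + α + 1) ↪ Fin n) →
      MvPolynomial (Fin n) ℤ :=
    Sum.elim (fun p => MvPolynomial.X p.1.1 ^ α - MvPolynomial.X p.1.2 ^ α) (detPoly e)
  refine ⟨∑ t, (Q t).totalDegree + 1, fun F _ _ hF => ?_⟩
  obtain ⟨x, hx⟩ := MvPolynomial.exists_forall_aeval_ne_zero (K := AlgebraicClosure F) Q hF (by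
    rintro (⟨⟨i, j⟩, hij⟩ | v)
    · refine ⟨Pi.single i 1, ?_⟩
      simp [Q, Ne.symm hij, hα.ne']
    · obtain ⟨z, hz⟩ := exists_det_clearedMatrix_ne_zero (AlgebraicClosure F) hα heα
      refine ⟨Function.extend v z 0, ?_⟩
      change MvPolynomial.aeval _ (detPoly e v) ≠ 0
      rw [aeval_detPoly, Function.extend_comp v.injective]
      exact hz)
  refine ⟨x, fun i j hij => ?_, fun v => ?_⟩
  · by_contra hne
    apply hx (Sum.inl ⟨(i, j), hne⟩)
    simpa [Q, sub_eq_zero] using hij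
  · rw [← aeval_detPoly]
    exact hx (Sum.inr v)

end Generic

/-! ### The main theorem -/

theorem mainTheorem8 (n k e : ℕ) (he : 1 ≤ e) (hek : e < k) (hn : 2 * k ≤ n + 1) :
    ∃ q₀ : ℕ, ∀ (F : Type*) [Field F] [Fintype F], q₀ ≤ Fintype.card F →
      ∃ x : Fin n → F,
        -- the Vandermonde encoding matrix with evaluation points `x` defines a PM code
        IsPMEncoding (vandermondePhi (k - 1) x) (fun i => x i ^ (k - 1)) ∧
        -- it is an `(n, k, 2k - e - 1, e, k - 1, e)` MSMR code
        IsMSMRCode (pmCode (vandermondePhi (k - 1) x) fun i => x i ^ (k - 1))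
          (k * (k - 1)) k (2 * k - e - 1) e e ∧
        -- no exact repair scheme of any code with the same storage has a smaller total bandwidth
        (∀ C : PMMessage (k - 1) F → Fin n → Fin (k - 1) → F, Reconstructs C k →
          ∀ E H : Finset (Fin n), E.card = e → H.card = 2 * k - e - 1 → Disjoint E H →
            ∀ b : H → ℕ, Nonempty (ExactRepair C E H b) →
              (2 * k - e - 1) * e ≤ ∑ h, b h) ∧
        -- for all failed nodes and helpers, the linear system for the cross terms is nonsingular
        -- and the repair by solving it returns the contents of the failed nodes
        ∀ v : Fin ((k - 1) + (k - 1) + 1) ↪ Fin n,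
          (repairMatrix (vandermondePhi (k - 1) x) (fun i => x i ^ (k - 1)) v e).det ≠ 0 ∧
          ∀ (m : PMMessage (k - 1) F) (i : FailedPos (k - 1) e),
            pmRepair (vandermondePhi (k - 1) x) (fun i => x i ^ (k - 1)) v e
                (pmDownload (vandermondePhi (k - 1) x) (fun i => x i ^ (k - 1)) v e m) i =
              pmCode (vandermondePhi (k - 1) x) (fun i => x i ^ (k - 1)) m (v i) := by
  obtain ⟨α, rfl⟩ : ∃ α, k = α + 1 := ⟨k - 1, by omega⟩
  rw [Nat.add_sub_cancel]
  obtain ⟨q₀, hq₀⟩ := exists_evaluation_points n (show 0 < α by omega) (show e ≤ α by omega)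
  refine ⟨q₀, fun F _ _ hF => ?_⟩
  obtain ⟨x, hx, hdet⟩ := hq₀ F hF
  have hPM := isPMEncoding_vandermondePhi hx
  have hrep := fun v => det_repairMatrix_ne_zero hx v (hdet v)
  obtain ⟨d, hd⟩ : ∃ d, 2 * (α + 1) - e - 1 = d := ⟨_, rfl⟩
  rw [hd]
  have hed : e + d = α + α + 1 := by omega
  refine ⟨x, hPM, ⟨card_pmMessage α F, by omega, by omega, hPM.reconstructs, ?_, ?_, ?_⟩, ?_, ?_⟩
  · intro E H hE hH hEH
    exact hPM.nonempty_exactRepair hed hrep hE hH hEH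
  · push_cast
    field_simp
  · have h1 : (e : ℚ) + d = α + α + 1 := by exact_mod_cast hed
    have h2 : (d : ℚ) - ((α + 1 : ℕ) : ℚ) + e = α := by
      push_cast
      linarith
    have h3 : (α : ℚ) ≠ 0 := by
      have : α ≠ 0 := by omega
      exact_mod_cast this
    rw [h2]
    push_cast
    field_simp
  · rintro C hC E H hE hH hEH b ⟨r⟩
    classical
    have hcard : Fintype.card H = d := by rw [Fintype.card_coe, hH]
    rw [← hcard]
    refine card_mul_le_sum_of_card_eq (show 0 < α by omega) (by omega) b fun T hT => ?_
    -- `Tᶜ` has `d - α = k - e` helpers, exactly enough to complete the failed nodes to `k`.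
    have h1 := r.card_mul_le_sum_compl hC (card_pmMessage α F) hEH Tᶜ (by
      rw [Finset.card_compl, hcard, hT]
      omega)
    rwa [hE, compl_compl] at h1
  · exact fun v => ⟨hrep v, pmRepair_pmDownload hPM v (hrep v)⟩
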